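/- For $n\in\mathbb{N}_0$ and $L>0$ let $C_n(L)\subseteq[0,L]$ denote the $n$-th iterate of the mid-third Cantor set based in $[0,L]$: $C_0(L)=[0,L]$, and $C_{n+1}(L)$ is obtained from $C_n(L)$, a union of $2^n$ disjoint closed intervals, by removing the open middle third of each of these intervals. For $R>0$ let $$\mathcal{C}_n(R)=\{(\omega,t)\in\mathbb{R}^2 : \omega^2+t^2\in C_n(R^2)\}$$ be the $n$-iterate spherically symmetric Cantor set in the disk of radius $R$. Let $\phi(x)=2^{1/4}e^{-\pi x^2}$ and, for $f\in L^2(\mathbb{R})$, let $$V_\phi f(\omega,t)=\int_{\mathbb{R}} f(x)\overline{\phi(x-t)}e^{-2\pi i\omega x}\,dx .$$ Let $P_{n,R}$ be Daubechies' localization operator localizing on $\mathcal{C}_n(R)$, i.e. the bounded linear operator on $L^2(\mathbb{R})$ determined by $$\langle P_{n,R}f,g\rangle=\iint_{\mathcal{C}_n(R)}V_\phi f(\omega,t)\,\overline{V_\phi g(\omega,t)}\,d\omega\,dt\qquad\text{for all } f,g\in L^2(\mathbb{R}).$$ Then, under the condition $3^n\sim(\pi R^2)^2$ (comparability up to multiplicative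 constants), the operator norm of $P_{n,R}$ is comparable to $(2/3)^{n/2}$. Precisely: for all constants $0<a\le A$ there exist constants $0<c_1\le c_2$, depending only on $a$ and $A$, such that for every $n=0,1,2,\dots$ and every $R>0$ with $$a\,(\pi R^2)^2\le 3^n\le A\,(\pi R^2)^2$$ one has $$c_1\left(\frac23\right)^{n/2}\le\|P_{n,R}\|_{\mathrm{op}}\le c_2\left(\frac23\right)^{n/2}.$$ -/

import Mathlib

namespace Daubechies

noncomputable section

open MeasureTheory ComplexConjugate

/-- The Hilbert space `L²(ℝ)` of complex-valued signals. -/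
abbrev L2 : Type := Lp ℂ 2 (volume : Measure ℝ)

/-- The short-time Fourier transform
`V_φ f (ω, t) = ∫ f(x) conj(φ(x - t)) exp(-2πi ω x) dx`. -/
def stft (φ f : ℝ → ℂ) (ω t : ℝ) : ℂ :=
  ∫ x, f x * conj (φ (x - t)) * Complex.exp (-(2 * Real.pi * Complex.I * ω * x))

/-- The time-frequency shift `x ↦ exp(2πi ω x) φ(x - t)` of the window. -/
def shift (φ : ℝ → ℂ) (ω t : ℝ) (x : ℝ) : ℂ :=
  Complex.exp ((2 * Real.pi * ω * x : ℝ) * Complex.I) * φ (x - t)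

theorem norm_shift (φ : ℝ → ℂ) (ω t x : ℝ) : ‖shift φ ω t x‖ = ‖φ (x - t)‖ := by
  rw [shift, norm_mul, Complex.norm_exp_ofReal_mul_I, one_mul]

theorem aestronglyMeasurable_shift {φ : ℝ → ℂ} (hφ : MemLp φ 2) (ω t : ℝ) :
    AEStronglyMeasurable (shift φ ω t) := by
  have h1 : AEStronglyMeasurable (fun x : ℝ => φ (x - t)) :=
    hφ.1.comp_measurePreserving (measurePreserving_sub_right volume t)
  exact (Continuous.aestronglyMeasurable (by fun_prop)).mul h1

theorem eLpNorm_shift {φ : ℝ → ℂ} (hφ : MemLp φ 2) (ω t : ℝ) :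
    eLpNorm (shift φ ω t) 2 = eLpNorm φ 2 := by
  rw [← eLpNorm_comp_measurePreserving hφ.1 (measurePreserving_sub_right volume t)]
  exact eLpNorm_congr_norm_ae (Filter.Eventually.of_forall fun x => norm_shift φ ω t x)

theorem memLp_shift {φ : ℝ → ℂ} (hφ : MemLp φ 2) (ω t : ℝ) : MemLp (shift φ ω t) 2 :=
  ⟨aestronglyMeasurable_shift hφ ω t, by rw [eLpNorm_shift hφ]; exact hφ.2⟩

theorem stft_eq_inner {φ : ℝ → ℂ} (hφ : MemLp φ 2) (f : L2) (ω t : ℝ) :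
    stft φ f ω t = inner ℂ ((memLp_shift hφ ω t).toLp _) f := by
  rw [L2.inner_def, stft]
  refine integral_congr_ae ?_
  filter_upwards [(memLp_shift hφ ω t).coeFn_toLp] with x hx
  rw [hx, RCLike.inner_apply, shift, map_mul, ← Complex.exp_conj, map_mul, Complex.conj_ofReal,
    Complex.conj_I]
  push_cast
  ring_nf

theorem norm_stft_le {φ : ℝ → ℂ} (hφ : MemLp φ 2) (f : L2) (ω t : ℝ) :
    ‖stft φ f ω t‖ ≤ (eLpNorm φ 2).toReal * ‖f‖ := by
  rw [stft_eq_inner hφ]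
  refine (norm_inner_le_norm _ _).trans_eq ?_
  rw [Lp.norm_toLp, eLpNorm_shift hφ]

theorem stft_add {φ : ℝ → ℂ} (hφ : MemLp φ 2) (f g : L2) (ω t : ℝ) :
    stft φ (f + g : L2) ω t = stft φ f ω t + stft φ g ω t := by
  simp only [stft_eq_inner hφ, inner_add_right]

theorem stft_smul {φ : ℝ → ℂ} (hφ : MemLp φ 2) (c : ℂ) (f : L2) (ω t : ℝ) :
    stft φ (c • f : L2) ω t = c * stft φ f ω t := by
  simp only [stft_eq_inner hφ, inner_smul_right]

theorem aestronglyMeasurable_stft {φ : ℝ → ℂ} (hφ : MemLp φ 2) (f : L2) :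
    AEStronglyMeasurable (fun z : ℝ × ℝ => stft φ f z.1 z.2) := by
  unfold stft
  refine AEStronglyMeasurable.integral_prod_right'
    (f := fun p : (ℝ × ℝ) × ℝ => f p.2 * conj (φ (p.2 - p.1.2)) *
      Complex.exp (-(2 * Real.pi * Complex.I * p.1.1 * p.2))) ?_
  have hq : Measure.QuasiMeasurePreserving (fun p : (ℝ × ℝ) × ℝ => p.2 - p.1.2)
      ((volume : Measure (ℝ × ℝ)).prod (volume : Measure ℝ)) volume := by
    refine QuasiMeasurePreserving.prod_of_right (by fun_prop)
      (Filter.Eventually.of_forall fun z => ?_)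
    exact (measurePreserving_sub_right volume z.2).quasiMeasurePreserving
  have h1 : AEStronglyMeasurable (fun p : (ℝ × ℝ) × ℝ => f p.2)
      ((volume : Measure (ℝ × ℝ)).prod (volume : Measure ℝ)) :=
    (Lp.aestronglyMeasurable f).comp_snd
  have h2 : AEStronglyMeasurable (fun p : (ℝ × ℝ) × ℝ => conj (φ (p.2 - p.1.2)))
      ((volume : Measure (ℝ × ℝ)).prod (volume : Measure ℝ)) :=
    Complex.continuous_conj.comp_aestronglyMeasurable
      (hφ.1.comp_quasiMeasurePreserving hq)
  exact (h1.mul h2).mul (Continuous.aestronglyMeasurable (by fun_prop))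

/-- The integrand `F(z) conj(V_φ f(z)) V_φ g(z)` is integrable on the time-frequency plane. -/
theorem integrable_weight_stft {F : ℝ × ℝ → ℝ} (hF : Integrable F) {φ : ℝ → ℂ}
    (hφ : MemLp φ 2) (f g : L2) :
    Integrable (fun z : ℝ × ℝ => (F z : ℂ) * (conj (stft φ f z.1 z.2) * stft φ g z.1 z.2)) := by
  refine hF.ofReal.mul_bdd (c := ((eLpNorm φ 2).toReal * ‖f‖) * ((eLpNorm φ 2).toReal * ‖g‖))
    ((Complex.continuous_conj.comp_aestronglyMeasurable
      (aestronglyMeasurable_stft hφ f)).mul (aestronglyMeasurable_stft hφ g))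
    (Filter.Eventually.of_forall fun z => ?_)
  rw [norm_mul, RCLike.norm_conj]
  exact mul_le_mul (norm_stft_le hφ f _ _) (norm_stft_le hφ g _ _) (norm_nonneg _) (by positivity)

/-- The bounded sesquilinear form `(f, g) ↦ ∬ F(ω, t) conj(V_φ f(ω, t)) V_φ g(ω, t) dω dt`
(conjugate-linear in `f`, linear in `g`, as is Mathlib's inner product) of a real-valued
integrable weight `F` and a window `φ ∈ L²(ℝ)`. -/
def form (F : ℝ × ℝ → ℝ) (φ : ℝ → ℂ) (hF : Integrable F) (hφ : MemLp φ 2) :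
    L2 →L⋆[ℂ] L2 →L[ℂ] ℂ :=
  LinearMap.mkContinuous₂
    (LinearMap.mk₂'ₛₗ (starRingEnd ℂ) (RingHom.id ℂ)
      (fun f g : L2 =>
        ∫ z : ℝ × ℝ, (F z : ℂ) * (conj (stft φ f z.1 z.2) * stft φ g z.1 z.2))
      (fun f f' g => by
        rw [← integral_add (integrable_weight_stft hF hφ f g)
          (integrable_weight_stft hF hφ f' g)]
        refine integral_congr_ae (Filter.Eventually.of_forall fun z => ?_)
        simp only [stft_add hφ, map_add]
        ring)
      (fun c f g => by
        rw [smul_eq_mul, ← integral_const_mul]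
        refine integral_congr_ae (Filter.Eventually.of_forall fun z => ?_)
        simp only [stft_smul hφ, map_mul]
        ring)
      (fun f g g' => by
        rw [← integral_add (integrable_weight_stft hF hφ f g)
          (integrable_weight_stft hF hφ f g')]
        refine integral_congr_ae (Filter.Eventually.of_forall fun z => ?_)
        simp only [stft_add hφ]
        ring)
      (fun c f g => by
        rw [RingHom.id_apply, smul_eq_mul, ← integral_const_mul]
        refine integral_congr_ae (Filter.Eventually.of_forall fun z => ?_)
        simp only [stft_smul hφ]
        ring))
    ((∫ z, ‖F z‖) * ((eLpNorm φ 2).toReal * (eLpNorm φ 2).toReal))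
    (fun f g => by
      simp only [LinearMap.mk₂'ₛₗ_apply]
      refine (norm_integral_le_of_norm_le (hF.norm.mul_const
        (((eLpNorm φ 2).toReal * ‖f‖) * ((eLpNorm φ 2).toReal * ‖g‖)))
        (Filter.Eventually.of_forall fun z => ?_)).trans_eq ?_
      · rw [norm_mul, norm_mul, RCLike.norm_conj, Complex.norm_real]
        exact mul_le_mul_of_nonneg_left (mul_le_mul (norm_stft_le hφ f _ _)
          (norm_stft_le hφ g _ _) (norm_nonneg _) (by positivity)) (norm_nonneg _)
      · rw [integral_mul_const]
        ring)

/-- Daubechies' localization operator `P_{F,φ}` with weight `F` and window `φ`: the bounded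
operator on `L²(ℝ)` that represents the form above (Riesz). -/
def localizationOperator (F : ℝ × ℝ → ℝ) (φ : ℝ → ℂ) (hF : Integrable F) (hφ : MemLp φ 2) :
    L2 →L[ℂ] L2 :=
  InnerProductSpace.continuousLinearMapOfBilin (form F φ hF hφ)

/-- The defining property `⟨P_{F,φ} f, g⟩ = ∬ F V_φ f conj(V_φ g) dω dt`, where `⟨u, v⟩` is linear
in `u` (Mathlib's `inner ℂ v u`). -/
theorem inner_localizationOperator (F : ℝ × ℝ → ℝ) (φ : ℝ → ℂ) (hF : Integrable F)
    (hφ : MemLp φ 2) (f g : L2) :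
    inner ℂ g (localizationOperator F φ hF hφ f) =
      ∫ z : ℝ × ℝ, (F z : ℂ) * stft φ f z.1 z.2 * conj (stft φ g z.1 z.2) := by
  rw [← inner_conj_symm, localizationOperator,
    InnerProductSpace.continuousLinearMapOfBilin_apply]
  simp only [form, LinearMap.mkContinuous₂_apply, LinearMap.mk₂'ₛₗ_apply]
  rw [← integral_conj]
  refine integral_congr_ae (Filter.Eventually.of_forall fun z => ?_)
  simp only [map_mul, Complex.conj_conj, Complex.conj_ofReal]
  ring

/-- The normalized Gaussian window `φ(x) = 2^{1/4} exp(-π x²)`. -/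
def gaussian (x : ℝ) : ℂ := ((2 : ℝ) ^ (1 / 4 : ℝ) * Real.exp (-Real.pi * x ^ 2) : ℝ)

theorem memLp_gaussian : MemLp gaussian 2 := by
  have hc : Continuous gaussian := by unfold gaussian; fun_prop
  rw [memLp_two_iff_integrable_sq_norm hc.aestronglyMeasurable]
  have h := (integrable_exp_neg_mul_sq (b := 2 * Real.pi) (by positivity)).const_mul
    (((2 : ℝ) ^ (1 / 4 : ℝ)) ^ 2)
  refine h.congr (Filter.Eventually.of_forall fun x => ?_)
  simp only [gaussian, Complex.norm_real, Real.norm_eq_abs, sq_abs, mul_pow, ← Real.exp_nat_mul]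
  congr 2
  push_cast
  ring

/-- The `n`-iterate mid-third Cantor set `C_n(L)` based in `[0, L]`: the image under `x ↦ L x` of
the `n`-th iterate `preCantorSet n` based in `[0, 1]`. -/
def cantorIterate (n : ℕ) (L : ℝ) : Set ℝ := (fun x => L * x) '' preCantorSet n

/-- The `n`-iterate spherically symmetric Cantor set
`{(ω, t) : ω² + t² ∈ C_n(R²)}` in the disk of radius `R`. -/
def sphericalCantor (n : ℕ) (R : ℝ) : Set (ℝ × ℝ) :=
  {z | z.1 ^ 2 + z.2 ^ 2 ∈ cantorIterate n (R ^ 2)}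

theorem isCompact_sphericalCantor (n : ℕ) (R : ℝ) : IsCompact (sphericalCantor n R) := by
  have h0 : IsCompact (preCantorSet n) :=
    isCompact_Icc.of_isClosed_subset (isClosed_preCantorSet n) preCantorSet_subset_unitInterval
  have h1 : IsCompact (cantorIterate n (R ^ 2)) := h0.image (by fun_prop)
  have h2 : IsClosed (sphericalCantor n R) :=
    h1.isClosed.preimage (f := fun z : ℝ × ℝ => z.1 ^ 2 + z.2 ^ 2) (by fun_prop)
  refine (isCompact_Icc (a := -|R|) (b := |R|) |>.prod
    (isCompact_Icc (a := -|R|) (b := |R|))).of_isClosed_subset h2 ?_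
  rintro ⟨ω, t⟩ ⟨x, hx, hxe⟩
  have hx1 := (preCantorSet_subset_unitInterval hx).2
  simp only at hxe
  have hle : R ^ 2 * x ≤ R ^ 2 := mul_le_of_le_one_right (sq_nonneg R) hx1
  exact ⟨abs_le.1 (sq_le_sq.1 (by nlinarith [sq_nonneg t])),
    abs_le.1 (sq_le_sq.1 (by nlinarith [sq_nonneg ω]))⟩

theorem integrable_sphericalCantor (n : ℕ) (R : ℝ) :
    Integrable ((sphericalCantor n R).indicator (fun _ => (1 : ℝ))) :=
  (integrable_indicator_iff (isCompact_sphericalCantor n R).measurableSet).2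
    (integrableOn_const (isCompact_sphericalCantor n R).measure_lt_top.ne)

/-- Daubechies' operator with Gaussian window localizing on the `n`-iterate spherically symmetric
Cantor set in the disk of radius `R`; its weight is the indicator function of that set. -/
def cantorOperator (n : ℕ) (R : ℝ) : L2 →L[ℂ] L2 :=
  localizationOperator ((sphericalCantor n R).indicator (fun _ => (1 : ℝ))) gaussian
    (integrable_sphericalCantor n R) memLp_gaussian

end

end Daubechies

namespace Daubechies

open MeasureTheory ComplexConjugate

/-! The kernel of the Gaussian short-time Fourier transform decays at unit scale in the plane, so
the operator norm for a set `E` is governed by the measure of `E` in unit boxes. For a radial set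
this reduces to the measure of the set of squared radii in intervals of length about 1. With `j = n
/ 2` the condition says exactly that the cell size `s = R² 3^{-j}` of the Cantor construction is
comparable to 1. An interval of length `s` contains at most `s (2/3)^{n-j}` of the set, and `[0, s]`
contains at least that much; both quantities are of order `(2/3)^{n/2}`.

Upper bound: with `V` the transform, `‖Pf‖² = ∫_E Vf · conj (V(Pf))`, and `V(Pf)` is `Vf` on `E`
integrated against a kernel of modulus `exp(-π|z-w|²/2)`. Schur's test bounds this by the kernel
mass of `E` times `∫_E |Vf|² = ⟨Pf, f⟩ ≤ ‖f‖ ‖Pf‖`, so no isometry property of `V` is needed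
(`norm_localizationOperator_indicator_le`). The kernel mass is controlled by unit boxes
(`exists_lintegral_gaussianKernel_le`), and the boxes by intervals
(`volume_radial_inter_closedBall_le`).

Lower bound: the Gaussian itself is the test function. Its transform has modulus bounded below near
the origin, where the radial set contains the full mass of one cell
(`le_norm_localizationOperator_indicator`). -/

/-! ### Mass of the Cantor iterates at scale `3^{-j}` -/

theorem mem_preCantorSet_succ {n : ℕ} {x : ℝ} :
    x ∈ preCantorSet (n + 1) ↔ 3 * x ∈ preCantorSet n ∨ 3 * x - 2 ∈ preCantorSet n := by
  rw [preCantorSet_succ]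
  constructor
  · rintro (⟨y, hy, rfl⟩ | ⟨y, hy, rfl⟩)
    · left; convert hy using 1; ring
    · right; convert hy using 1; ring
  · rintro (h | h)
    · exact Or.inl ⟨_, h, by ring⟩
    · exact Or.inr ⟨_, h, by ring⟩

theorem measurableSet_preCantorSet (n : ℕ) : MeasurableSet (preCantorSet n) :=
  (isClosed_preCantorSet n).measurableSet

theorem volume_preimage_three_mul_sub (s : Set ℝ) (b : ℝ) :
    volume ((fun x : ℝ => 3 * x - b) ⁻¹' s) = ENNReal.ofReal (1 / 3) * volume s := by
  have h := Real.volume_preimage_mul_left (a := 3) (by norm_num) ((fun y => y - b) ⁻¹' s)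
  have h2 : volume ((fun y : ℝ => y - b) ⁻¹' s) = volume s := by
    simpa only [sub_eq_add_neg] using measure_preimage_add_right volume (-b) s
  rw [h2] at h
  have h3 : |(3 : ℝ)⁻¹| = 1 / 3 := by norm_num
  rw [h3] at h
  exact h

/-- The `n`-th iterate has measure `(2/3)^n`. -/
theorem volume_preCantorSet (n : ℕ) :
    volume (preCantorSet n) = ENNReal.ofReal ((2 / 3) ^ n) := by
  induction n with
  | zero => simp
  | succ n ih =>
    have h : preCantorSet (n + 1) =
        (fun x : ℝ => 3 * x - 0) ⁻¹' preCantorSet n ∪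
          (fun x : ℝ => 3 * x - 2) ⁻¹' preCantorSet n := by
      ext x
      rw [mem_preCantorSet_succ]
      simp
    have hd : Disjoint ((fun x : ℝ => 3 * x - 0) ⁻¹' preCantorSet n)
        ((fun x : ℝ => 3 * x - 2) ⁻¹' preCantorSet n) := by
      rw [Set.disjoint_left]
      intro x hx hx'
      have h1 := (preCantorSet_subset_unitInterval hx).2
      have h2 := (preCantorSet_subset_unitInterval hx').1
      simp only at h1 h2
      linarith
    have hm : Measurable fun x : ℝ => 3 * x - 2 := by fun_prop
    rw [h, measure_union hd (hm (measurableSet_preCantorSet n)), volume_preimage_three_mul_sub,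
      volume_preimage_three_mul_sub, ih, ← ENNReal.ofReal_mul (by norm_num),
      ← ENNReal.ofReal_add (by positivity) (by positivity)]
    congr 1
    ring

/-- An interval of length `3^{-j}` meets at most a `2^{-j}` fraction of the `n`-th iterate. -/
theorem volume_preCantorSet_inter_Ico_le {n j : ℕ} (hj : j ≤ n) (c : ℝ) :
    volume (preCantorSet n ∩ Set.Ico c (c + (1 / 3) ^ j)) ≤
      ENNReal.ofReal ((2 / 3) ^ n * (1 / 2) ^ j) := by
  induction j generalizing n c with
  | zero =>
    rw [pow_zero, pow_zero, mul_one, ← volume_preCantorSet]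
    exact measure_mono Set.inter_subset_left
  | succ j ih =>
    obtain ⟨n, rfl⟩ : ∃ m, n = m + 1 := ⟨n - 1, by omega⟩
    have hpow : (1 / 3 : ℝ) ^ j ≤ 1 := pow_le_one₀ (by norm_num) (by norm_num)
    have key : ∃ b : ℝ, preCantorSet (n + 1) ∩ Set.Ico c (c + (1 / 3) ^ (j + 1)) ⊆
        (fun x : ℝ => 3 * x - b) ⁻¹'
          (preCantorSet n ∩ Set.Ico (3 * c - b) (3 * c - b + (1 / 3) ^ j)) := by
      rw [pow_succ]
      -- The interval has length at most 1/3 and is half-open, so it misses the right third if `c ≤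
      -- 1/3` and the left third otherwise. Rescaling the surviving third by 3 reduces to `j`.
      by_cases hc : c ≤ 1 / 3
      · refine ⟨0, ?_⟩
        rintro x ⟨hx, hx1, hx2⟩
        rcases mem_preCantorSet_succ.1 hx with h | h
        · exact ⟨by simpa using h, by simp only; linarith, by simp only; linarith⟩
        · have := (preCantorSet_subset_unitInterval h).1
          linarith
      · refine ⟨2, ?_⟩
        rintro x ⟨hx, hx1, hx2⟩
        rcases mem_preCantorSet_succ.1 hx with h | h
        · have := (preCantorSet_subset_unitInterval h).2
          linarith
        · exact ⟨by simpa using h, by simp only; linarith, by simp only; linarith⟩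
    obtain ⟨b, hb⟩ := key
    refine (measure_mono hb).trans ?_
    rw [volume_preimage_three_mul_sub]
    refine (mul_le_mul_right (ih (by omega) _) _).trans_eq ?_
    rw [← ENNReal.ofReal_mul (by norm_num)]
    congr 1
    ring

/-- Self-similarity of the leftmost cell. The upper bound for intervals of length `3^{-j}` is thus
attained at the origin, where the test Gaussian concentrates. -/
theorem le_volume_preCantorSet_inter_Icc {n j : ℕ} (hj : j ≤ n) :
    ENNReal.ofReal ((2 / 3) ^ n * (1 / 2) ^ j) ≤
      volume (preCantorSet n ∩ Set.Icc 0 ((1 / 3) ^ j)) := by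
  induction j generalizing n with
  | zero =>
    rw [pow_zero, mul_one, ← volume_preCantorSet, pow_zero]
    exact measure_mono (Set.subset_inter subset_rfl preCantorSet_subset_unitInterval)
  | succ j ih =>
    obtain ⟨n, rfl⟩ : ∃ m, n = m + 1 := ⟨n - 1, by omega⟩
    have hs : (fun x : ℝ => 3 * x - 0) ⁻¹' (preCantorSet n ∩ Set.Icc 0 ((1 / 3) ^ j)) ⊆
        preCantorSet (n + 1) ∩ Set.Icc 0 ((1 / 3) ^ (j + 1)) := by
      rintro x ⟨hx, hx1, hx2⟩
      rw [pow_succ]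
      simp only [sub_zero] at hx hx1 hx2
      exact ⟨mem_preCantorSet_succ.2 (Or.inl hx), by linarith, by linarith⟩
    refine le_trans ?_ (measure_mono hs)
    rw [volume_preimage_three_mul_sub]
    refine le_trans (le_of_eq ?_) (mul_le_mul_right (ih (n := n) (by omega)) _)
    rw [← ENNReal.ofReal_mul (by norm_num)]
    congr 1
    ring

/-! ### Rescaling to `[0, L]` and passing to arbitrary intervals -/

theorem cantorIterate_eq_preimage (n : ℕ) {L : ℝ} (hL : 0 < L) :
    cantorIterate n L = (fun x => L⁻¹ * x) ⁻¹' preCantorSet n := by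
  ext x
  constructor
  · rintro ⟨y, hy, rfl⟩
    simpa [hL.ne'] using hy
  · intro hx
    exact ⟨_, hx, by field_simp⟩

theorem measurableSet_cantorIterate (n : ℕ) {L : ℝ} (hL : 0 < L) :
    MeasurableSet (cantorIterate n L) := by
  rw [cantorIterate_eq_preimage n hL]
  exact measurableSet_preCantorSet n |>.preimage (by fun_prop)

theorem volume_preimage_inv_mul {L : ℝ} (hL : 0 < L) (s : Set ℝ) :
    volume ((fun x => L⁻¹ * x) ⁻¹' s) = ENNReal.ofReal L * volume s := by
  rw [Real.volume_preimage_mul_left (inv_ne_zero hL.ne'), inv_inv, abs_of_pos hL]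

theorem volume_cantorIterate_inter_Ico_le {n j : ℕ} (hj : j ≤ n) {L : ℝ} (hL : 0 < L) (c : ℝ) :
    volume (cantorIterate n L ∩ Set.Ico c (c + L * (1 / 3) ^ j)) ≤
      ENNReal.ofReal (L * ((2 / 3) ^ n * (1 / 2) ^ j)) := by
  have hs : cantorIterate n L ∩ Set.Ico c (c + L * (1 / 3) ^ j) ⊆ (fun x => L⁻¹ * x) ⁻¹'
      (preCantorSet n ∩ Set.Ico (L⁻¹ * c) (L⁻¹ * c + (1 / 3) ^ j)) := by
    rw [cantorIterate_eq_preimage n hL]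
    rintro x ⟨hx, hx1, hx2⟩
    refine ⟨hx, mul_le_mul_of_nonneg_left hx1 (by positivity), ?_⟩
    have := mul_lt_mul_of_pos_left hx2 (inv_pos.2 hL)
    rwa [mul_add, inv_mul_cancel_left₀ hL.ne'] at this
  refine (measure_mono hs).trans ?_
  rw [volume_preimage_inv_mul hL, ENNReal.ofReal_mul hL.le]
  exact mul_le_mul_right (volume_preCantorSet_inter_Ico_le hj _) _

theorem le_volume_cantorIterate_inter_Icc {n j : ℕ} (hj : j ≤ n) {L : ℝ} (hL : 0 < L) :
    ENNReal.ofReal (L * ((2 / 3) ^ n * (1 / 2) ^ j)) ≤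
      volume (cantorIterate n L ∩ Set.Icc 0 (L * (1 / 3) ^ j)) := by
  have hs : (fun x => L⁻¹ * x) ⁻¹' (preCantorSet n ∩ Set.Icc 0 ((1 / 3) ^ j)) ⊆
      cantorIterate n L ∩ Set.Icc 0 (L * (1 / 3) ^ j) := by
    rw [cantorIterate_eq_preimage n hL]
    rintro x ⟨hx, hx1, hx2⟩
    simp only at hx1 hx2
    refine ⟨hx, ?_, ?_⟩
    · have := mul_nonneg hL.le hx1
      rwa [mul_inv_cancel_left₀ hL.ne'] at this
    · have := mul_le_mul_of_nonneg_left hx2 hL.le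
      rwa [mul_inv_cancel_left₀ hL.ne'] at this
  refine le_trans ?_ (measure_mono hs)
  rw [volume_preimage_inv_mul hL, ENNReal.ofReal_mul hL.le]
  exact mul_le_mul_right (le_volume_preCantorSet_inter_Icc hj) _

/-- A set that is `ε`-small in every interval of length `ℓ` is `(k ε)`-small in every interval of
length `k ℓ`. -/
theorem volume_inter_Ico_nat_mul_le {S : Set ℝ} {ℓ : ℝ} {ε : ENNReal}
    (h : ∀ c, volume (S ∩ Set.Ico c (c + ℓ)) ≤ ε) (k : ℕ) (c : ℝ) :
    volume (S ∩ Set.Ico c (c + k * ℓ)) ≤ k * ε := by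
  induction k with
  | zero => simp
  | succ k ih =>
    have hs : S ∩ Set.Ico c (c + (k + 1 : ℕ) * ℓ) ⊆
        S ∩ Set.Ico c (c + k * ℓ) ∪ S ∩ Set.Ico (c + k * ℓ) (c + k * ℓ + ℓ) := by
      rintro x ⟨hx, hx1, hx2⟩
      push_cast at hx2
      rcases lt_or_ge x (c + k * ℓ) with h1 | h1
      · exact Or.inl ⟨hx, hx1, h1⟩
      · exact Or.inr ⟨hx, h1, by linarith⟩
    refine (measure_mono hs).trans ((measure_union_le _ _).trans ?_)
    rw [Nat.cast_succ]
    rw [add_mul, one_mul]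
    exact add_le_add ih (h _)

theorem volume_inter_Icc_le {S : Set ℝ} {ℓ : ℝ} (hℓ : 0 < ℓ) {ε : ENNReal}
    (h : ∀ c, volume (S ∩ Set.Ico c (c + ℓ)) ≤ ε) {c d : ℝ} (hcd : c ≤ d) :
    volume (S ∩ Set.Icc c d) ≤ ENNReal.ofReal ((d - c) / ℓ + 1) * ε := by
  have h0 : 0 ≤ (d - c) / ℓ := div_nonneg (by linarith) hℓ.le
  have h1 : d < c + (⌊(d - c) / ℓ⌋₊ + 1 : ℕ) * ℓ := by
    have := Nat.lt_floor_add_one ((d - c) / ℓ)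
    rw [div_lt_iff₀ hℓ] at this
    push_cast
    linarith
  have hs : Set.Icc c d ⊆ Set.Ico c (c + (⌊(d - c) / ℓ⌋₊ + 1 : ℕ) * ℓ) := fun x hx =>
    ⟨hx.1, hx.2.trans_lt h1⟩
  refine (measure_mono (Set.inter_subset_inter_right S hs)).trans ((volume_inter_Ico_nat_mul_le h _ c).trans ?_)
  gcongr
  rw [← ENNReal.ofReal_natCast]
  apply ENNReal.ofReal_le_ofReal
  push_cast
  linarith [Nat.floor_le h0]

/-! ### Radial planar sets: from squared radii to unit boxes -/

theorem image_sq_Ioi_zero : (fun r : ℝ => r ^ 2) '' Set.Ioi 0 = Set.Ioi 0 := by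
  ext u
  constructor
  · rintro ⟨r, hr, rfl⟩
    exact pow_pos (Set.mem_Ioi.1 hr) 2
  · intro hu
    exact ⟨√u, Real.sqrt_pos.2 hu, Real.sq_sqrt (le_of_lt hu)⟩

/-- Area of a radially symmetric set. -/
theorem volume_sq_add_sq_mem {S : Set ℝ} (hS : MeasurableSet S) :
    volume {w : ℝ × ℝ | w.1 ^ 2 + w.2 ^ 2 ∈ S} =
      ENNReal.ofReal Real.pi * volume (S ∩ Set.Ioi 0) := by
  have hmeas : MeasurableSet {w : ℝ × ℝ | w.1 ^ 2 + w.2 ^ 2 ∈ S} :=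
    hS.preimage (f := fun w : ℝ × ℝ => w.1 ^ 2 + w.2 ^ 2) (by fun_prop)
  -- Substitution `u = r²`; the factor 2 of the Jacobian turns the angular `2π` into `π`.
  have h1 : volume (S ∩ Set.Ioi 0) =
      2 * ∫⁻ r in Set.Ioi (0 : ℝ), ENNReal.ofReal r * S.indicator 1 (r ^ 2) := by
    rw [← lintegral_const_mul' _ _ (by simp), ← Measure.restrict_apply hS,
      ← lintegral_indicator_one hS]
    conv_lhs => rw [← image_sq_Ioi_zero]
    rw [lintegral_image_eq_lintegral_abs_deriv_mul measurableSet_Ioi (f' := fun r => 2 * r)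
      (fun x _ => by simpa using (hasDerivAt_pow 2 x).hasDerivWithinAt)
      (fun x hx y hy h => (pow_left_inj₀ (le_of_lt hx) (le_of_lt hy) two_ne_zero).1 h)]
    refine setLIntegral_congr_fun measurableSet_Ioi fun r hr => ?_
    have hr' : 0 < r := hr
    rw [abs_of_pos (by positivity), ENNReal.ofReal_mul (by norm_num), mul_assoc]
    simp
  rw [h1, ← lintegral_indicator_one hmeas, ← lintegral_comp_polarCoord_symm, polarCoord_target,
    Measure.volume_eq_prod, ← Measure.prod_restrict]
  have h2 : ∀ p : ℝ × ℝ, ENNReal.ofReal p.1 •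
      ({w : ℝ × ℝ | w.1 ^ 2 + w.2 ^ 2 ∈ S}.indicator 1 (polarCoord.symm p) : ENNReal) =
      (ENNReal.ofReal p.1 * S.indicator 1 (p.1 ^ 2)) * 1 := by
    intro p
    have : (polarCoord.symm p).1 ^ 2 + (polarCoord.symm p).2 ^ 2 = p.1 ^ 2 := by
      rw [polarCoord_symm_apply, mul_pow, mul_pow, ← mul_add, Real.cos_sq_add_sin_sq, mul_one]
    have hiff : polarCoord.symm p ∈ {w : ℝ × ℝ | w.1 ^ 2 + w.2 ^ 2 ∈ S} ↔ p.1 ^ 2 ∈ S := by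
      rw [Set.mem_ofPred_eq, this]
    rw [smul_eq_mul, mul_one]
    by_cases hp : p.1 ^ 2 ∈ S
    · rw [Set.indicator_of_mem hp, Set.indicator_of_mem (hiff.2 hp), Pi.one_apply,
        Pi.one_apply]
    · rw [Set.indicator_of_notMem hp, Set.indicator_of_notMem (mt hiff.1 hp)]
  simp_rw [h2]
  have hind : Measurable fun r : ℝ => ENNReal.ofReal r * S.indicator 1 (r ^ 2) :=
    ENNReal.measurable_ofReal.mul
      ((measurable_one.indicator hS).comp (measurable_id.pow_const 2))
  rw [lintegral_prod_mul hind.aemeasurable aemeasurable_const]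
  simp only [lintegral_const, Measure.restrict_apply MeasurableSet.univ, Set.univ_inter,
    Real.volume_Ioo, one_mul]
  rw [show Real.pi - -Real.pi = 2 * Real.pi by ring, ENNReal.ofReal_mul (by norm_num),
    ENNReal.ofReal_ofNat]
  ring

/-- Substitution `u = t² + b` away from `t = 0`. -/
theorem volume_sq_add_mem_le {S : Set ℝ} (hS : MeasurableSet S) (b : ℝ) {p : ℝ} (hp : 0 < p)
    (q : ℝ) :
    volume {t | t ∈ Set.Icc p q ∧ t ^ 2 + b ∈ S} ≤
      ENNReal.ofReal (1 / (2 * p)) * volume (S ∩ Set.Icc (p ^ 2 + b) (q ^ 2 + b)) := by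
  set T := {t | t ∈ Set.Icc p q ∧ t ^ 2 + b ∈ S} with hT
  have hTm : MeasurableSet T :=
    measurableSet_Icc.inter (hS.preimage (f := fun t : ℝ => t ^ 2 + b) (by fun_prop))
  have hpos : ∀ t ∈ T, 0 < t := fun t ht => hp.trans_le ht.1.1
  have h1 : (fun t => t ^ 2 + b) '' T ⊆ S ∩ Set.Icc (p ^ 2 + b) (q ^ 2 + b) := by
    rintro _ ⟨t, ht, rfl⟩
    have := hpos t ht
    have h1 := ht.1.1
    have h2 := ht.1.2
    exact ⟨ht.2, by simp only; gcongr, by simp only; gcongr⟩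
  have h2 := lintegral_image_eq_lintegral_abs_deriv_mul hTm (f := fun t => t ^ 2 + b)
    (f' := fun r => 2 * r)
    (fun x _ => by simpa using ((hasDerivAt_pow 2 x).add_const b).hasDerivWithinAt)
    (fun x hx y hy h =>
      (pow_left_inj₀ (hpos x hx).le (hpos y hy).le two_ne_zero).1 (add_right_cancel h)) 1
  have h3 : ENNReal.ofReal (2 * p) * volume T ≤ volume ((fun t => t ^ 2 + b) '' T) := by
    have h4 : ENNReal.ofReal (2 * p) * volume T = ∫⁻ _ in T, ENNReal.ofReal (2 * p) := by simp
    have h5 : volume ((fun t => t ^ 2 + b) '' T) =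
        ∫⁻ x in (fun t => t ^ 2 + b) '' T, (1 : ℝ → ENNReal) x := by simp
    rw [h4, h5, h2]
    refine setLIntegral_mono' hTm fun t ht => ?_
    have := ht.1.1
    rw [Pi.one_apply, mul_one, abs_of_pos (by linarith [hpos t ht])]
    exact ENNReal.ofReal_le_ofReal (by linarith)
  calc volume T = ENNReal.ofReal (1 / (2 * p)) * (ENNReal.ofReal (2 * p) * volume T) := by
        rw [← mul_assoc, ← ENNReal.ofReal_mul (by positivity),
          one_div_mul_cancel (by positivity), ENNReal.ofReal_one, one_mul]
    _ ≤ _ := mul_le_mul_right (h3.trans (measure_mono h1)) _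

/-- If `S` has measure at most `(d - c + 1) ε` in every interval `[c, d]`, then a slice
`{t : t² + b ∈ S}` has measure at most `4ε` in every interval of length `1` away from
`(-1, 1)`. -/
theorem volume_slice_le {S : Set ℝ} (hS : MeasurableSet S) {ε : ENNReal}
    (h : ∀ c d, c ≤ d → volume (S ∩ Set.Icc c d) ≤ ENNReal.ofReal (d - c + 1) * ε) (b s : ℝ) :
    volume {t | t ∈ Set.Icc (s - 1 / 2) (s + 1 / 2) ∧ 1 ≤ |t| ∧ t ^ 2 + b ∈ S} ≤ 4 * ε := by
  -- On `[p, q]` with `p ≥ 1` and `q ≤ p + 1`, the image under squaring has length at most `2p + 1`,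
  -- so it meets `S` in at most `(2p + 2) ε`. The Jacobian divides by `2p`, and `(2p + 2)/(2p) ≤ 2`.
  have pos : ∀ s : ℝ, volume {t | t ∈ Set.Icc (max 1 (s - 1 / 2)) (s + 1 / 2) ∧ t ^ 2 + b ∈ S} ≤
      2 * ε := by
    intro s
    set p := max 1 (s - 1 / 2) with hp
    set q := s + 1 / 2 with hq
    have hp1 : 1 ≤ p := le_max_left _ _
    have hpq : q ≤ p + 1 := by linarith [le_max_right 1 (s - 1 / 2)]
    by_cases hle : p ≤ q
    · refine (volume_sq_add_mem_le hS b (by linarith) q).trans ?_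
      refine (mul_le_mul_right (h _ _ (by nlinarith)) _).trans ?_
      rw [← mul_assoc, ← ENNReal.ofReal_mul (by positivity)]
      gcongr
      rw [← ENNReal.ofReal_ofNat]
      apply ENNReal.ofReal_le_ofReal
      rw [one_div_mul_eq_div, div_le_iff₀ (by linarith)]
      nlinarith
    · rw [Set.Icc_eq_empty hle]
      simp
  have hs : {t | t ∈ Set.Icc (s - 1 / 2) (s + 1 / 2) ∧ 1 ≤ |t| ∧ t ^ 2 + b ∈ S} ⊆
      {t | t ∈ Set.Icc (max 1 (s - 1 / 2)) (s + 1 / 2) ∧ t ^ 2 + b ∈ S} ∪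
      (fun t => -t) ⁻¹' {t | t ∈ Set.Icc (max 1 (-s - 1 / 2)) (-s + 1 / 2) ∧ t ^ 2 + b ∈ S} := by
    rintro t ⟨⟨h1, h2⟩, h3, h4⟩
    rcases le_abs.1 h3 with h5 | h5
    · exact Or.inl ⟨⟨max_le h5 h1, h2⟩, h4⟩
    · exact Or.inr ⟨⟨max_le h5 (by linarith), by linarith⟩, by simpa using h4⟩
  refine (measure_mono hs).trans ((measure_union_le _ _).trans ?_)
  rw [Measure.measure_preimage_neg volume]
  refine (add_le_add (pos s) (pos (-s))).trans_eq ?_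
  ring

/-- Fubini over vertical slices: fixing the first coordinate `x` gives the slice estimate with `b =
x²`, and the box has width 1. The restriction `1 ≤ |w.2|` keeps the Jacobian of squaring away from
zero. -/
theorem volume_radial_inter_closedBall_snd_le {S : Set ℝ} (hS : MeasurableSet S) {ε : ENNReal}
    (h : ∀ c d, c ≤ d → volume (S ∩ Set.Icc c d) ≤ ENNReal.ofReal (d - c + 1) * ε) (z : ℝ × ℝ) :
    volume {w : ℝ × ℝ | w ∈ Metric.closedBall z (1 / 2) ∧ 1 ≤ |w.2| ∧ w.1 ^ 2 + w.2 ^ 2 ∈ S} ≤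
      4 * ε := by
  have hm : MeasurableSet
      {w : ℝ × ℝ | w ∈ Metric.closedBall z (1 / 2) ∧ 1 ≤ |w.2| ∧ w.1 ^ 2 + w.2 ^ 2 ∈ S} := by
    refine Metric.isClosed_closedBall.measurableSet.inter (MeasurableSet.inter ?_ ?_)
    · exact (isClosed_le continuous_const continuous_snd.abs).measurableSet
    · exact hS.preimage (f := fun w : ℝ × ℝ => w.1 ^ 2 + w.2 ^ 2) (by fun_prop)
  rw [Measure.volume_eq_prod, Measure.prod_apply hm]
  have hb : ∀ x : ℝ, volume (Prod.mk x ⁻¹'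
      {w : ℝ × ℝ | w ∈ Metric.closedBall z (1 / 2) ∧ 1 ≤ |w.2| ∧ w.1 ^ 2 + w.2 ^ 2 ∈ S}) ≤
      (Metric.closedBall z.1 (1 / 2)).indicator (fun _ => 4 * ε) x := by
    intro x
    by_cases hx : x ∈ Metric.closedBall z.1 (1 / 2)
    · rw [Set.indicator_of_mem hx]
      refine le_trans (measure_mono ?_) (volume_slice_le hS h (x ^ 2) z.2)
      rintro t ⟨h1, h2, h3⟩
      rw [← closedBall_prod_same] at h1
      have h4 := h1.2
      rw [Real.closedBall_eq_Icc] at h4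
      exact ⟨h4, h2, by rw [add_comm]; exact h3⟩
    · rw [Set.indicator_of_notMem hx, nonpos_iff_eq_zero]
      refine measure_mono_null (t := ∅) ?_ (by simp)
      rintro t ⟨h1, -⟩
      rw [← closedBall_prod_same] at h1
      exact hx h1.1
  refine (lintegral_mono hb).trans_eq ?_
  rw [lintegral_indicator Metric.isClosed_closedBall.measurableSet, setLIntegral_const,
    Real.volume_closedBall]
  norm_num

/-- A radially symmetric set inherits smallness in unit boxes from smallness in intervals of the
set of squared radii. -/
theorem volume_radial_inter_closedBall_le {S : Set ℝ} (hS : MeasurableSet S) {ε : ENNReal}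
    (h : ∀ c d, c ≤ d → volume (S ∩ Set.Icc c d) ≤ ENNReal.ofReal (d - c + 1) * ε) (z : ℝ × ℝ) :
    volume ({w : ℝ × ℝ | w.1 ^ 2 + w.2 ^ 2 ∈ S} ∩ Metric.closedBall z (1 / 2)) ≤ 20 * ε := by
  -- Either some coordinate is at least 1 in modulus, and one slices along it (`4ε` each, by
  -- symmetry), or the squared radius is below 2. The latter region contributes at most `3πε ≤ 12ε`
  -- by the polar formula.
  have hs : {w : ℝ × ℝ | w.1 ^ 2 + w.2 ^ 2 ∈ S} ∩ Metric.closedBall z (1 / 2) ⊆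
      ({w : ℝ × ℝ | w ∈ Metric.closedBall z (1 / 2) ∧ 1 ≤ |w.2| ∧ w.1 ^ 2 + w.2 ^ 2 ∈ S} ∪
      Prod.swap ⁻¹' {w : ℝ × ℝ | w ∈ Metric.closedBall z.swap (1 / 2) ∧ 1 ≤ |w.2| ∧
        w.1 ^ 2 + w.2 ^ 2 ∈ S}) ∪ {w : ℝ × ℝ | w.1 ^ 2 + w.2 ^ 2 ∈ S ∩ Set.Icc 0 2} := by
    rintro w ⟨h1, h2⟩
    by_cases h3 : 1 ≤ |w.2|
    · exact Or.inl (Or.inl ⟨h2, h3, h1⟩)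
    by_cases h4 : 1 ≤ |w.1|
    · refine Or.inl (Or.inr ⟨?_, h4, by simpa [add_comm] using h1⟩)
      rw [← closedBall_prod_same] at h2 ⊢
      exact ⟨h2.2, h2.1⟩
    · have h5 := (sq_lt_one_iff_abs_lt_one w.1).2 (not_le.1 h4)
      have h6 := (sq_lt_one_iff_abs_lt_one w.2).2 (not_le.1 h3)
      exact Or.inr ⟨h1, by positivity, by linarith⟩
  have hswap : MeasurePreserving (Prod.swap : ℝ × ℝ → ℝ × ℝ) volume volume :=
    Measure.measurePreserving_swap
  have h1 := volume_radial_inter_closedBall_snd_le hS h z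
  have h2 := (hswap.measure_preimage_equiv (f := MeasurableEquiv.prodComm) _).trans_le
    (volume_radial_inter_closedBall_snd_le hS h z.swap)
  have h3 : volume {w : ℝ × ℝ | w.1 ^ 2 + w.2 ^ 2 ∈ S ∩ Set.Icc 0 2} ≤ 12 * ε := by
    rw [volume_sq_add_sq_mem (hS.inter measurableSet_Icc)]
    refine (mul_le_mul_right ((measure_mono Set.inter_subset_left).trans
      (h 0 2 (by norm_num))) _).trans ?_
    rw [← mul_assoc, ← ENNReal.ofReal_mul Real.pi_pos.le]
    gcongr
    rw [← ENNReal.ofReal_ofNat]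
    apply ENNReal.ofReal_le_ofReal
    linarith [Real.pi_le_four]
  refine (measure_mono hs).trans ((measure_union_le _ _).trans
    ((add_le_add_left (measure_union_le _ _) _).trans ?_))
  refine (add_le_add (add_le_add h1 h2) h3).trans_eq ?_
  ring

/-! ### Gaussian atoms and their inner products -/

/-- The time-frequency shift of the Gaussian window by `z = (ω, t)`, as an element of `L²(ℝ)`. -/
noncomputable def gaussianAtom (z : ℝ × ℝ) : L2 := (memLp_shift memLp_gaussian z.1 z.2).toLp _

theorem stft_gaussian_eq_inner (f : L2) (z : ℝ × ℝ) :
    stft gaussian f z.1 z.2 = inner ℂ (gaussianAtom z) f :=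
  stft_eq_inner memLp_gaussian f z.1 z.2

/-- The integrand is the exponential of a quadratic. Completing the square leaves a real Gaussian
factor and a pure phase, which the norm removes; the constants `2^{1/2}` and `(1/2)^{1/2}` cancel.
-/
theorem norm_inner_gaussianAtom (w z : ℝ × ℝ) :
    ‖inner ℂ (gaussianAtom w) (gaussianAtom z)‖ =
      Real.exp (-(Real.pi / 2) * ((z.1 - w.1) ^ 2 + (z.2 - w.2) ^ 2)) := by
  have h1 : inner ℂ (gaussianAtom w) (gaussianAtom z) = ((2 : ℝ) ^ (1 / 2 : ℝ) : ℝ) *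
      ∫ x : ℝ, Complex.exp ((-(2 * Real.pi : ℝ) : ℂ) * x ^ 2 +
        ((2 * Real.pi * (z.2 + w.2) : ℝ) + (2 * Real.pi * (z.1 - w.1) : ℝ) * Complex.I) * x +
        (-(Real.pi * (z.2 ^ 2 + w.2 ^ 2)) : ℝ)) := by
    rw [L2.inner_def, ← integral_const_mul]
    refine integral_congr_ae ?_
    filter_upwards [(memLp_shift memLp_gaussian w.1 w.2).coeFn_toLp,
      (memLp_shift memLp_gaussian z.1 z.2).coeFn_toLp] with x hw hz
    rw [gaussianAtom, gaussianAtom, hw, hz, RCLike.inner_apply, shift, shift, map_mul,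
      ← Complex.exp_conj, map_mul, Complex.conj_ofReal, Complex.conj_I, gaussian, gaussian,
      Complex.conj_ofReal]
    have h2 : ((2 : ℝ) ^ (1 / 2 : ℝ)) = 2 ^ (1 / 4 : ℝ) * 2 ^ (1 / 4 : ℝ) := by
      rw [← Real.rpow_add (by norm_num)]
      norm_num
    rw [h2]
    simp only [Complex.ofReal_mul, Complex.ofReal_exp]
    have h3 : ∀ a b c d e r : ℂ, a + b + c + d = e →
        Complex.exp a * (r * Complex.exp b) * (Complex.exp c * (r * Complex.exp d)) =
          r * r * Complex.exp e := by
      rintro a b c d e r rfl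
      rw [Complex.exp_add, Complex.exp_add, Complex.exp_add]
      ring
    refine h3 _ _ _ _ _ _ ?_
    push_cast
    ring
  have hb : ((-(2 * Real.pi : ℝ) : ℂ)).re < 0 := by
    rw [← Complex.ofReal_neg, Complex.ofReal_re]
    linarith [Real.pi_pos]
  have h6 : ((-(Real.pi * (z.2 ^ 2 + w.2 ^ 2)) : ℝ) : ℂ) -
      ((2 * Real.pi * (z.2 + w.2) : ℝ) + (2 * Real.pi * (z.1 - w.1) : ℝ) * Complex.I) ^ 2 /
        (4 * (-(2 * Real.pi : ℝ) : ℂ)) =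
      ((-(Real.pi / 2) * ((z.1 - w.1) ^ 2 + (z.2 - w.2) ^ 2) : ℝ) : ℂ) +
        ((Real.pi * (z.2 + w.2) * (z.1 - w.1) : ℝ) : ℂ) * Complex.I := by
    have : (Real.pi : ℂ) ≠ 0 := by exact_mod_cast Real.pi_ne_zero
    push_cast
    field_simp
    ring_nf
    simp only [Complex.I_sq]
    ring
  rw [h1, integral_cexp_quadratic hb, h6, norm_mul, norm_mul, Complex.norm_exp]
  have h4 : ((Real.pi : ℂ) / -(-(2 * Real.pi : ℝ) : ℂ)) = ((1 / 2 : ℝ) : ℂ) := by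
    have : (Real.pi : ℂ) ≠ 0 := by exact_mod_cast Real.pi_ne_zero
    push_cast
    field_simp
  have h5 : ((1 : ℂ) / 2) = ((1 / 2 : ℝ) : ℂ) := by push_cast; rfl
  rw [h4, h5, ← Complex.ofReal_cpow (by norm_num), Complex.norm_real, Complex.norm_real,
    Real.norm_of_nonneg (by positivity), Real.norm_of_nonneg (by positivity), ← mul_assoc,
    ← Real.mul_rpow (by norm_num) (by norm_num), Complex.add_re, Complex.ofReal_re,
    Complex.re_ofReal_mul, Complex.I_re, mul_zero, add_zero]
  norm_num

theorem norm_gaussianAtom (z : ℝ × ℝ) : ‖gaussianAtom z‖ = 1 := by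
  have h := norm_inner_gaussianAtom z z
  rw [inner_self_eq_norm_sq_to_K] at h
  have h1 : ‖gaussianAtom z‖ ^ 2 = 1 := by simpa using h
  exact (pow_eq_one_iff_of_nonneg (norm_nonneg _) two_ne_zero).1 h1

/-! ### Schur's test and the operator norm -/

theorem mul_le_sq_add_sq (a b : ENNReal) : a * b ≤ a ^ 2 + b ^ 2 := by
  rcases le_total a b with h | h
  · exact (mul_le_mul_left h b).trans (by rw [← sq]; exact le_add_self)
  · exact (mul_le_mul_right h a).trans (by rw [← sq]; exact le_self_add)

/-- Schur's test for a symmetric kernel. -/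
theorem lintegral_mul_lintegral_kernel_le {α : Type*} [MeasurableSpace α] {μ : Measure α}
    [SFinite μ] {u : α → ENNReal} (hu : AEMeasurable u μ) (hu' : ∀ z, u z ≠ ⊤)
    {k : α → α → ENNReal} (hk : Measurable fun p : α × α => k p.1 p.2)
    (hsymm : ∀ z w, k z w = k w z) {B : ENNReal} (hB : B ≠ ⊤) (h : ∀ z, ∫⁻ w, k z w ∂μ ≤ B) :
    ∫⁻ z, u z * ∫⁻ w, u w * k z w ∂μ ∂μ ≤ 2 * (B * ∫⁻ z, u z ^ 2 ∂μ) := by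
  have hk1 : ∀ z, Measurable fun w => k z w := fun z =>
    hk.comp (measurable_const.prodMk measurable_id)
  have h1 : ∀ z, u z * ∫⁻ w, u w * k z w ∂μ ≤
      (∫⁻ w, u z ^ 2 * k z w ∂μ) + ∫⁻ w, u w ^ 2 * k z w ∂μ := by
    intro z
    rw [← lintegral_const_mul' _ _ (hu' z), ← lintegral_add_left ((hk1 z).const_mul _)]
    refine lintegral_mono fun w => ?_
    rw [← mul_assoc, ← add_mul]
    exact mul_le_mul_left (mul_le_sq_add_sq _ _) _
  have h2 : ∀ z, ∫⁻ w, u z ^ 2 * k z w ∂μ ≤ B * u z ^ 2 := by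
    intro z
    rw [lintegral_const_mul _ (hk1 z), mul_comm]
    exact mul_le_mul_left (h z) _
  have h3 : ∫⁻ z, ∫⁻ w, u w ^ 2 * k z w ∂μ ∂μ ≤ B * ∫⁻ z, u z ^ 2 ∂μ := by
    rw [lintegral_lintegral_swap, ← lintegral_const_mul' _ _ hB]
    · refine lintegral_mono fun w => ?_
      simp_rw [hsymm _ w]
      exact h2 w
    · exact ((hu.comp_snd (μ := μ)).pow_const 2).mul hk.aemeasurable
  refine (lintegral_mono fun z => (h1 z).trans (add_le_add_left (h2 z) _)).trans ?_
  rw [lintegral_add_left' ((hu.pow_const 2).const_mul _), lintegral_const_mul' _ _ hB, two_mul]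
  exact add_le_add_right h3 _

/-- The absolute value `exp(-π|z - w|²/2)` of the reproducing kernel of the Gaussian window. -/
noncomputable def gaussianKernel (z w : ℝ × ℝ) : ENNReal :=
  ENNReal.ofReal (Real.exp (-(Real.pi / 2) * ((z.1 - w.1) ^ 2 + (z.2 - w.2) ^ 2)))

theorem gaussianKernel_comm (z w : ℝ × ℝ) : gaussianKernel z w = gaussianKernel w z := by
  rw [gaussianKernel, gaussianKernel, ← neg_sub w.1, ← neg_sub w.2, neg_sq, neg_sq]

theorem measurable_gaussianKernel :
    Measurable fun p : (ℝ × ℝ) × (ℝ × ℝ) => gaussianKernel p.1 p.2 := by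
  unfold gaussianKernel
  fun_prop

theorem enorm_inner_gaussianAtom (w z : ℝ × ℝ) :
    ‖inner ℂ (gaussianAtom w) (gaussianAtom z)‖ₑ = gaussianKernel z w := by
  rw [← ofReal_norm, norm_inner_gaussianAtom, gaussianKernel]

/-- The operator localizing on a set, in terms of the Gaussian window. -/
theorem inner_localizationOperator_indicator {E : Set (ℝ × ℝ)} (hE : MeasurableSet E)
    (hi : Integrable (E.indicator fun _ => (1 : ℝ))) (f g : L2) :
    inner ℂ g (localizationOperator (E.indicator fun _ => (1 : ℝ)) gaussian hi memLp_gaussian f) =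
      ∫ z in E, inner ℂ (gaussianAtom z) f * conj (inner ℂ (gaussianAtom z) g) := by
  rw [inner_localizationOperator, ← integral_indicator hE]
  refine integral_congr_ae (Filter.Eventually.of_forall fun z => ?_)
  simp only [stft_gaussian_eq_inner]
  by_cases hz : z ∈ E
  · simp [hz]
  · simp [hz]

/-- Schur's test for the reproducing kernel bounds the operator localizing on `E`. -/
theorem norm_localizationOperator_indicator_le {E : Set (ℝ × ℝ)} (hE : MeasurableSet E)
    (hi : Integrable (E.indicator fun _ => (1 : ℝ))) {B : ℝ} (hB : 0 ≤ B)
    (h : ∀ z, ∫⁻ w in E, gaussianKernel z w ≤ ENNReal.ofReal B) :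
    ‖localizationOperator (E.indicator fun _ => (1 : ℝ)) gaussian hi memLp_gaussian‖ ≤ 2 * B := by
  set P := localizationOperator (E.indicator fun _ => (1 : ℝ)) gaussian hi memLp_gaussian with hP
  refine ContinuousLinearMap.opNorm_le_bound _ (by positivity) fun f => ?_
  have hfin : Integrable (fun z : ℝ × ℝ => ‖inner ℂ (gaussianAtom z) f‖ ^ 2)
      (volume.restrict E) := by
    have := (integrable_weight_stft hi memLp_gaussian f f).norm.integrableOn (s := E)
    refine this.congr_fun (fun z hz => ?_) hE
    simp only [stft_gaussian_eq_inner]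
    rw [norm_mul, norm_mul, RCLike.norm_conj, Set.indicator_of_mem hz, Complex.ofReal_one, norm_one,
      one_mul, sq]
  have hmeas : AEMeasurable (fun z : ℝ × ℝ => ‖inner ℂ (gaussianAtom z) f‖ₑ)
      (volume.restrict E) := by
    have := (aestronglyMeasurable_stft memLp_gaussian f).enorm.restrict (s := E)
    simpa only [stft_gaussian_eq_inner] using this
  set Q := ∫⁻ z in E, ‖inner ℂ (gaussianAtom z) f‖ₑ ^ 2 with hQ
  -- `Q` is the quadratic form `⟨Pf, f⟩`, so Cauchy–Schwarz applies.
  have hQ1 : Q ≤ ‖f‖ₑ * ‖P f‖ₑ := by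
    have h1 : inner ℂ f (P f) = ((∫ z in E, ‖inner ℂ (gaussianAtom z) f‖ ^ 2 : ℝ) : ℂ) := by
      rw [inner_localizationOperator_indicator hE, ← integral_complex_ofReal]
      refine integral_congr_ae (Filter.Eventually.of_forall fun z => ?_)
      simp only [RCLike.mul_conj]
      push_cast
      rfl
    have h2 : Q = ‖inner ℂ f (P f)‖ₑ := by
      have h0 : 0 ≤ ∫ z in E, ‖inner ℂ (gaussianAtom z) f‖ ^ 2 :=
        integral_nonneg fun z => by positivity
      rw [h1, ← ofReal_norm, Complex.norm_real, Real.norm_of_nonneg h0,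
        ofReal_integral_eq_lintegral_ofReal hfin
          (Filter.Eventually.of_forall fun z => by positivity), hQ]
      refine lintegral_congr fun z => ?_
      rw [ENNReal.ofReal_pow (norm_nonneg _), ofReal_norm]
    rw [h2, ← ofReal_norm, ← ofReal_norm, ← ofReal_norm,
      ← ENNReal.ofReal_mul (norm_nonneg _)]
    exact ENNReal.ofReal_le_ofReal (norm_inner_le_norm _ _)
  have hP1 : ∀ z, ‖inner ℂ (gaussianAtom z) (P f)‖ₑ ≤
      ∫⁻ w in E, ‖inner ℂ (gaussianAtom w) f‖ₑ * gaussianKernel z w := by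
    intro z
    rw [inner_localizationOperator_indicator hE]
    refine (enorm_integral_le_lintegral_enorm _).trans_eq (lintegral_congr fun w => ?_)
    rw [enorm_mul, RCLike.enorm_conj, enorm_inner_gaussianAtom]
  have hP2 : ‖P f‖ₑ ^ 2 ≤
      ∫⁻ z in E, ‖inner ℂ (gaussianAtom z) f‖ₑ * ‖inner ℂ (gaussianAtom z) (P f)‖ₑ := by
    have h1 : ‖P f‖ₑ ^ 2 = ‖inner ℂ (P f) (P f)‖ₑ := by
      rw [inner_self_eq_norm_sq_to_K, ← ofReal_norm, ← ofReal_norm,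
        ← ENNReal.ofReal_pow (norm_nonneg _)]
      simp
    rw [h1, inner_localizationOperator_indicator hE hi f (P f)]
    refine (enorm_integral_le_lintegral_enorm _).trans_eq (lintegral_congr fun w => ?_)
    rw [enorm_mul, RCLike.enorm_conj]
  -- Together with `hQ1` this gives `‖Pf‖² ≤ 2B ‖f‖ ‖Pf‖`, from which one factor `‖Pf‖` is
  -- cancelled.
  have hP3 : ‖P f‖ₑ ^ 2 ≤ 2 * (ENNReal.ofReal B * Q) :=
    (hP2.trans (lintegral_mono fun z => mul_le_mul_right (hP1 z) _)).trans
      (lintegral_mul_lintegral_kernel_le hmeas (fun _ => enorm_ne_top) measurable_gaussianKernel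
        gaussianKernel_comm ENNReal.ofReal_ne_top h)
  have hP4 : ‖P f‖ₑ ^ 2 ≤ ENNReal.ofReal (2 * B * (‖f‖ * ‖P f‖)) := by
    refine hP3.trans ?_
    rw [← mul_assoc, ENNReal.ofReal_mul (by positivity), ENNReal.ofReal_mul (by norm_num),
      ENNReal.ofReal_ofNat, ENNReal.ofReal_mul (norm_nonneg _), ofReal_norm,
      ofReal_norm]
    exact mul_le_mul_right hQ1 _
  rw [← ofReal_norm, ← ENNReal.ofReal_pow (norm_nonneg _),
    ENNReal.ofReal_le_ofReal_iff (by positivity)] at hP4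
  rcases (norm_nonneg (P f)).eq_or_lt with h0 | h0
  · rw [← h0]
    positivity
  · nlinarith

/-- The quadratic form of the operator at the Gaussian. -/
theorem le_norm_localizationOperator_indicator {E : Set (ℝ × ℝ)} (hE : MeasurableSet E)
    (hi : Integrable (E.indicator fun _ => (1 : ℝ))) {κ : ℝ} :
    Real.exp (-Real.pi * κ) * volume.real (E ∩ {w | w.1 ^ 2 + w.2 ^ 2 ≤ κ}) ≤
    ‖localizationOperator (E.indicator fun _ => (1 : ℝ)) gaussian hi memLp_gaussian‖ := by
  set P := localizationOperator (E.indicator fun _ => (1 : ℝ)) gaussian hi memLp_gaussian with hP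
  have hEi : IntegrableOn (fun _ => (1 : ℝ)) E := (integrable_indicator_iff hE).1 hi
  have hfin : IntegrableOn (fun z : ℝ × ℝ => Real.exp (-Real.pi * (z.1 ^ 2 + z.2 ^ 2))) E := by
    refine Integrable.mono' hEi (Continuous.aestronglyMeasurable (by fun_prop))
      (Filter.Eventually.of_forall fun z => ?_)
    rw [Real.norm_of_nonneg (by positivity), Real.exp_le_one_iff]
    nlinarith [Real.pi_pos, sq_nonneg z.1, sq_nonneg z.2]
  have h1 : inner ℂ (gaussianAtom 0) (P (gaussianAtom 0)) =
      ((∫ z in E, Real.exp (-Real.pi * (z.1 ^ 2 + z.2 ^ 2)) : ℝ) : ℂ) := by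
    rw [inner_localizationOperator_indicator hE, ← integral_complex_ofReal]
    refine integral_congr_ae (Filter.Eventually.of_forall fun z => ?_)
    simp only [RCLike.mul_conj, norm_inner_gaussianAtom]
    rw [← RCLike.ofReal_pow, ← Real.exp_nat_mul]
    simp only [Prod.fst_zero, Prod.snd_zero]
    congr 2
    push_cast
    ring
  have h2 : ∫ z in E, Real.exp (-Real.pi * (z.1 ^ 2 + z.2 ^ 2)) ≤ ‖P‖ := by
    have h3 := (norm_inner_le_norm (𝕜 := ℂ) (gaussianAtom 0) (P (gaussianAtom 0))).trans
      (mul_le_mul_of_nonneg_left (P.le_opNorm _) (norm_nonneg _))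
    rw [h1, norm_gaussianAtom, one_mul, mul_one, Complex.norm_real] at h3
    exact (le_abs_self _).trans h3
  refine le_trans ?_ h2
  have hm : MeasurableSet {w : ℝ × ℝ | w.1 ^ 2 + w.2 ^ 2 ≤ κ} :=
    (isClosed_le (by fun_prop) continuous_const).measurableSet
  have h4 : IntegrableOn (fun _ => (1 : ℝ)) (E ∩ {w | w.1 ^ 2 + w.2 ^ 2 ≤ κ}) :=
    hEi.mono_set Set.inter_subset_left
  calc Real.exp (-Real.pi * κ) * volume.real (E ∩ {w | w.1 ^ 2 + w.2 ^ 2 ≤ κ})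
      = ∫ z in E ∩ {w | w.1 ^ 2 + w.2 ^ 2 ≤ κ}, Real.exp (-Real.pi * κ) * 1 := by
        rw [integral_const_mul]; simp
    _ ≤ ∫ z in E ∩ {w | w.1 ^ 2 + w.2 ^ 2 ≤ κ}, Real.exp (-Real.pi * (z.1 ^ 2 + z.2 ^ 2)) := by
        refine setIntegral_mono_on (h4.const_mul _) (hfin.mono_set Set.inter_subset_left)
          (hE.inter hm) fun z hz => ?_
        rw [mul_one, Real.exp_le_exp]
        have : z.1 ^ 2 + z.2 ^ 2 ≤ κ := hz.2
        nlinarith [Real.pi_pos]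
    _ ≤ _ := setIntegral_mono_set hfin
        (Filter.Eventually.of_forall fun z => (Real.exp_pos _).le)
        Set.inter_subset_left.eventuallyLE

/-- The mass of the Gaussian kernel on a set is bounded by the measure of the set in unit
boxes. -/
theorem exists_lintegral_gaussianKernel_le : ∃ C : ℝ, 0 < C ∧
    ∀ {E : Set (ℝ × ℝ)} (_ : MeasurableSet E) {ε : ENNReal}
      (_ : ∀ c, volume (E ∩ Metric.closedBall c (1 / 2)) ≤ ε) (z : ℝ × ℝ),
      ∫⁻ w in E, gaussianKernel z w ≤ ENNReal.ofReal C * ε := by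
  -- Half the decay rate of the kernel. Moving `w` by at most 1/2 in each coordinate costs `(z-s)² ≤
  -- 2(z-w)² + 1/2` per coordinate, hence the total loss `exp(π/4)`.
  set k : ℝ × ℝ → ℝ := fun s => Real.exp (-(Real.pi / 4) * s.1 ^ 2) *
    Real.exp (-(Real.pi / 4) * s.2 ^ 2) with hk
  have hki : Integrable k :=
    (integrable_exp_neg_mul_sq (by positivity)).mul_prod (integrable_exp_neg_mul_sq (by positivity))
  have hk0 : ∀ s, 0 ≤ k s := fun s => by positivity
  have hkc : Continuous k := by fun_prop
  have hI : 0 ≤ ∫ s, k s := integral_nonneg hk0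
  refine ⟨Real.exp (Real.pi / 4) * (∫ s, k s) + 1, by positivity, ?_⟩
  intro E hE ε h z
  -- The kernel is dominated by an average of `k` over the box of area 1 around `w`. After
  -- exchanging the integrals, the inner one is the measure of `E` in a unit box.
  have h1 : ∀ w, gaussianKernel z w ≤ ENNReal.ofReal (Real.exp (Real.pi / 4)) *
      ∫⁻ s, (Metric.closedBall w (1 / 2)).indicator (fun s => ENNReal.ofReal (k (z - s))) s := by
    intro w
    rw [lintegral_indicator Metric.isClosed_closedBall.measurableSet]
    have hv : volume (Metric.closedBall w (1 / 2)) = 1 := by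
      rw [← closedBall_prod_same, Measure.volume_eq_prod, Measure.prod_prod,
        Real.volume_closedBall, Real.volume_closedBall]
      norm_num
    have h2 : ∀ s ∈ Metric.closedBall w (1 / 2), gaussianKernel z w ≤
        ENNReal.ofReal (Real.exp (Real.pi / 4)) * ENNReal.ofReal (k (z - s)) := by
      intro s hs
      rw [← closedBall_prod_same] at hs
      have h3 := abs_le.1 (Real.dist_eq _ _ ▸ Metric.mem_closedBall.1 hs.1)
      have h4 := abs_le.1 (Real.dist_eq _ _ ▸ Metric.mem_closedBall.1 hs.2)
      rw [← ENNReal.ofReal_mul (by positivity), gaussianKernel, hk]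
      simp only [Prod.fst_sub, Prod.snd_sub]
      rw [← Real.exp_add, ← Real.exp_add]
      refine ENNReal.ofReal_le_ofReal (Real.exp_le_exp.2 ?_)
      have h5 : (z.1 - s.1) ^ 2 ≤ 2 * (z.1 - w.1) ^ 2 + 1 / 2 := by
        nlinarith [sq_nonneg (z.1 - w.1 + (s.1 - w.1))]
      have h6 : (z.2 - s.2) ^ 2 ≤ 2 * (z.2 - w.2) ^ 2 + 1 / 2 := by
        nlinarith [sq_nonneg (z.2 - w.2 + (s.2 - w.2))]
      nlinarith [Real.pi_pos]
    rw [← lintegral_const_mul' _ _ ENNReal.ofReal_ne_top]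
    refine le_trans (le_of_eq ?_)
      (setLIntegral_mono' Metric.isClosed_closedBall.measurableSet h2)
    rw [setLIntegral_const, hv, mul_one]
  have hkm : Measurable fun s => ENNReal.ofReal (k (z - s)) := by fun_prop
  have hind : Measurable fun p : (ℝ × ℝ) × (ℝ × ℝ) =>
      (Metric.closedBall p.1 (1 / 2)).indicator (fun s => ENNReal.ofReal (k (z - s))) p.2 := by
    have hc : MeasurableSet {p : (ℝ × ℝ) × (ℝ × ℝ) | dist p.2 p.1 ≤ 1 / 2} :=
      (isClosed_le (by fun_prop) continuous_const).measurableSet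
    exact (hkm.comp measurable_snd).indicator hc
  calc ∫⁻ w in E, gaussianKernel z w
      ≤ ∫⁻ w in E, ENNReal.ofReal (Real.exp (Real.pi / 4)) * ∫⁻ s,
          (Metric.closedBall w (1 / 2)).indicator (fun s => ENNReal.ofReal (k (z - s))) s :=
        lintegral_mono h1
    _ = ENNReal.ofReal (Real.exp (Real.pi / 4)) * ∫⁻ s, ∫⁻ w in E,
          (Metric.closedBall w (1 / 2)).indicator (fun s => ENNReal.ofReal (k (z - s))) s := by
        rw [lintegral_const_mul' _ _ ENNReal.ofReal_ne_top, lintegral_lintegral_swap]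
        exact hind.aemeasurable
    _ ≤ ENNReal.ofReal (Real.exp (Real.pi / 4)) * ∫⁻ s, ENNReal.ofReal (k (z - s)) * ε := by
        gcongr with s
        have h2 : ∀ w, (Metric.closedBall w (1 / 2)).indicator
            (fun s => ENNReal.ofReal (k (z - s))) s =
            (Metric.closedBall s (1 / 2)).indicator
              (fun _ => ENNReal.ofReal (k (z - s))) w := by
          intro w
          simp only [Set.indicator, Metric.mem_closedBall, dist_comm]
        simp_rw [h2]
        rw [lintegral_indicator Metric.isClosed_closedBall.measurableSet, setLIntegral_const,
          Measure.restrict_apply Metric.isClosed_closedBall.measurableSet, Set.inter_comm]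
        gcongr
        exact h s
    _ = ENNReal.ofReal (Real.exp (Real.pi / 4) * ∫ s, k s) * ε := by
        rw [lintegral_mul_const _ hkm, lintegral_sub_left_eq_self (fun s => ENNReal.ofReal (k s)) z,
          ← ofReal_integral_eq_lintegral_ofReal hki (Filter.Eventually.of_forall hk0),
          ← mul_assoc, ← ENNReal.ofReal_mul (by positivity)]
    _ ≤ _ := by
        gcongr
        linarith

/-! ### Two-sided bounds for the Cantor operator at a given cell size -/

theorem norm_cantorOperator_le {C : ℝ} (hC : 0 < C)
    (hK : ∀ {E : Set (ℝ × ℝ)} (_ : MeasurableSet E) {ε : ENNReal}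
      (_ : ∀ c, volume (E ∩ Metric.closedBall c (1 / 2)) ≤ ε) (z : ℝ × ℝ),
      ∫⁻ w in E, gaussianKernel z w ≤ ENNReal.ofReal C * ε)
    {n j : ℕ} (hj : j ≤ n) {R : ℝ} (hR : 0 < R) {ℓ : ℝ} (hℓ : 0 < ℓ)
    (h : ℓ ≤ R ^ 2 * (1 / 3) ^ j) :
    ‖cantorOperator n R‖ ≤
      40 * C * ((1 / ℓ + 1) * (R ^ 2 * ((2 / 3) ^ n * (1 / 2) ^ j))) := by
  set m := R ^ 2 * ((2 / 3 : ℝ) ^ n * (1 / 2) ^ j) with hm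
  have hm0 : 0 ≤ m := by positivity
  have hL : 0 < R ^ 2 := by positivity
  have hS := measurableSet_cantorIterate n hL
  -- Covering by cells of size at least `ℓ` needs at most `(d-c)/ℓ + 1 ≤ (d-c+1)(1/ℓ+1)` of them,
  -- which puts the bound in the form used for radial sets.
  have hd : ∀ c d, c ≤ d → volume (cantorIterate n (R ^ 2) ∩ Set.Icc c d) ≤
      ENNReal.ofReal (d - c + 1) * ENNReal.ofReal ((1 / ℓ + 1) * m) := by
    intro c d hcd
    refine (volume_inter_Icc_le (hℓ.trans_le h)
      (volume_cantorIterate_inter_Ico_le hj hL) hcd).trans ?_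
    rw [← hm, ENNReal.ofReal_mul (p := 1 / ℓ + 1) (by positivity), ← mul_assoc,
      ← ENNReal.ofReal_mul (p := d - c + 1) (by linarith)]
    refine mul_le_mul_left (ENNReal.ofReal_le_ofReal ?_) _
    have h1 : (d - c) / (R ^ 2 * (1 / 3) ^ j) ≤ (d - c) / ℓ :=
      div_le_div_of_nonneg_left (by linarith) hℓ h
    have h2 : (d - c + 1) * (1 / ℓ + 1) = (d - c) / ℓ + 1 + (1 / ℓ + (d - c)) := by ring
    have h3 : 0 < 1 / ℓ := by positivity
    linarith
  have hB : ∀ z, ∫⁻ w in sphericalCantor n R, gaussianKernel z w ≤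
      ENNReal.ofReal (20 * C * ((1 / ℓ + 1) * m)) := by
    intro z
    refine (hK (isCompact_sphericalCantor n R).measurableSet
      (volume_radial_inter_closedBall_le hS hd) z).trans_eq ?_
    rw [← ENNReal.ofReal_ofNat, ← ENNReal.ofReal_mul (by norm_num), ← ENNReal.ofReal_mul hC.le]
    congr 1
    ring
  refine (norm_localizationOperator_indicator_le (isCompact_sphericalCantor n R).measurableSet
    (integrable_sphericalCantor n R) (by positivity) hB).trans_eq ?_
  ring

theorem le_norm_cantorOperator {n j : ℕ} (hj : j ≤ n) {R : ℝ} (hR : 0 < R) {κ : ℝ}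
    (h : R ^ 2 * (1 / 3) ^ j ≤ κ) :
    Real.exp (-Real.pi * κ) * (Real.pi * (R ^ 2 * ((2 / 3) ^ n * (1 / 2) ^ j))) ≤
      ‖cantorOperator n R‖ := by
  have hL : 0 < R ^ 2 := by positivity
  refine le_trans ?_ (le_norm_localizationOperator_indicator (κ := κ)
    (isCompact_sphericalCantor n R).measurableSet (integrable_sphericalCantor n R))
  gcongr
  have hfin : volume (sphericalCantor n R ∩ {w | w.1 ^ 2 + w.2 ^ 2 ≤ κ}) ≠ ⊤ :=
    measure_ne_top_of_subset Set.inter_subset_left (isCompact_sphericalCantor n R).measure_ne_top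
  rw [Measure.real, ← ENNReal.ofReal_le_iff_le_toReal hfin, ENNReal.ofReal_mul Real.pi_pos.le]
  have hs : sphericalCantor n R ∩ {w | w.1 ^ 2 + w.2 ^ 2 ≤ κ} =
      {w | w.1 ^ 2 + w.2 ^ 2 ∈ cantorIterate n (R ^ 2) ∩ Set.Iic κ} := rfl
  rw [hs, volume_sq_add_sq_mem ((measurableSet_cantorIterate n hL).inter measurableSet_Iic)]
  gcongr
  refine (le_volume_cantorIterate_inter_Icc hj hL).trans ?_
  -- The polar formula sees only positive squared radii, so the null point 0 is split off.
  have hs' : cantorIterate n (R ^ 2) ∩ Set.Icc 0 (R ^ 2 * (1 / 3) ^ j) ⊆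
      cantorIterate n (R ^ 2) ∩ Set.Iic κ ∩ Set.Ioi 0 ∪ {0} := by
    rintro x ⟨hx, hx0, hx1⟩
    rcases hx0.eq_or_lt with h0 | h0
    · exact Or.inr h0.symm
    · exact Or.inl ⟨⟨hx, hx1.trans h⟩, h0⟩
  refine (measure_mono hs').trans ((measure_union_le _ _).trans_eq ?_)
  rw [Real.volume_singleton, add_zero]

/-- The exponent `n - n / 2` is `n/2` rounded up, so parity costs at most a factor `(2/3)^{1/2} ≥
2/3`. -/
theorem two_thirds_pow_sub_half_bounds (n : ℕ) :
    2 / 3 * (2 / 3 : ℝ) ^ ((n : ℝ) / 2) ≤ (2 / 3) ^ (n - n / 2) ∧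
      (2 / 3 : ℝ) ^ (n - n / 2) ≤ (2 / 3 : ℝ) ^ ((n : ℝ) / 2) := by
  have h1 : n ≤ 2 * (n - n / 2) := by omega
  have h2 : 2 * (n - n / 2) ≤ n + 1 := by omega
  have h1' : (n : ℝ) ≤ 2 * ((n - n / 2 : ℕ) : ℝ) := by exact_mod_cast h1
  have h2' : 2 * ((n - n / 2 : ℕ) : ℝ) ≤ n + 1 := by exact_mod_cast h2
  rw [← Real.rpow_natCast]
  constructor
  · calc 2 / 3 * (2 / 3 : ℝ) ^ ((n : ℝ) / 2) = (2 / 3 : ℝ) ^ (1 + (n : ℝ) / 2) := by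
          rw [Real.rpow_add (by norm_num), Real.rpow_one]
      _ ≤ _ := Real.rpow_le_rpow_of_exponent_ge (by norm_num) (by norm_num) (by linarith)
  · exact Real.rpow_le_rpow_of_exponent_ge (by norm_num) (by norm_num) (by linarith)

theorem nine_pow_half_bounds (n : ℕ) :
    (9 : ℝ) ^ (n / 2) ≤ 3 ^ n ∧ (3 : ℝ) ^ n ≤ 3 * 9 ^ (n / 2) := by
  rw [show (9 : ℝ) = 3 ^ 2 by norm_num, ← pow_mul, ← pow_succ']
  exact ⟨pow_le_pow_right₀ (by norm_num) (by omega), pow_le_pow_right₀ (by norm_num) (by omega)⟩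

end Daubechies

/-! ### Choice of scale and constants -/

open Daubechies in
theorem mainTheorem2 (a A : ℝ) (ha : 0 < a) (haA : a ≤ A) :
    ∃ c₁ c₂ : ℝ, 0 < c₁ ∧ c₁ ≤ c₂ ∧
      ∀ (n : ℕ) (R : ℝ), 0 < R →
        a * (Real.pi * R ^ 2) ^ 2 ≤ (3 : ℝ) ^ n →
        (3 : ℝ) ^ n ≤ A * (Real.pi * R ^ 2) ^ 2 →
          c₁ * (2 / 3 : ℝ) ^ ((n : ℝ) / 2) ≤ ‖Daubechies.cantorOperator n R‖ ∧
          ‖Daubechies.cantorOperator n R‖ ≤ c₂ * (2 / 3 : ℝ) ^ ((n : ℝ) / 2) := by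
  obtain ⟨C, hC, hK⟩ := exists_lintegral_gaussianKernel_le
  have hA : 0 < A := ha.trans_le haA
  -- These bracket the cell size `s = R² 3^{-⌊n/2⌋}`. Since `R⁴ = s² 9^{⌊n/2⌋}` and `9^{⌊n/2⌋} ≤ 3^n
  -- ≤ 3 · 9^{⌊n/2⌋}`, the hypotheses give `1/(π²A) ≤ s² ≤ 3/(π²a)`; the 3 accounts for odd `n`.
  set ℓ := √(1 / (Real.pi ^ 2 * A)) with hℓ
  set κ := √(3 / (Real.pi ^ 2 * a)) with hκ
  have hℓ0 : 0 < ℓ := Real.sqrt_pos.2 (by positivity)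
  have hκ0 : 0 < κ := Real.sqrt_pos.2 (by positivity)
  set c₁ := Real.exp (-Real.pi * κ) * (Real.pi * (ℓ * (2 / 3))) with hc₁
  set c₂ := 40 * C * ((1 / ℓ + 1) * κ) with hc₂
  -- The maximum secures the required ordering of the constants without comparing `c₁` with `c₂`.
  refine ⟨c₁, max c₁ c₂, by positivity, le_max_left _ _, fun n R hR h1 h2 => ?_⟩
  obtain ⟨hq1, hq2⟩ := two_thirds_pow_sub_half_bounds n
  obtain ⟨h91, h92⟩ := nine_pow_half_bounds n
  set q := (2 / 3 : ℝ) ^ ((n : ℝ) / 2) with hq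
  have hq0 : 0 < q := Real.rpow_pos_of_pos (by norm_num) _
  have hj : n / 2 ≤ n := Nat.div_le_self _ _
  set s := R ^ 2 * (1 / 3 : ℝ) ^ (n / 2) with hs
  have hs0 : 0 < s := by positivity
  have hm : R ^ 2 * ((2 / 3 : ℝ) ^ n * (1 / 2) ^ (n / 2)) = s * (2 / 3) ^ (n - n / 2) := by
    rw [hs, mul_assoc]
    congr 1
    have h3 : (1 / 3 : ℝ) ^ (n / 2) = (2 / 3) ^ (n / 2) * (1 / 2) ^ (n / 2) := by
      rw [← mul_pow]; norm_num
    rw [h3, mul_right_comm, ← pow_add, Nat.add_sub_cancel' hj]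
  have hs2 : s ^ 2 * 9 ^ (n / 2) = (R ^ 2) ^ 2 := by
    rw [hs, mul_pow, pow_right_comm (1 / 3 : ℝ), mul_assoc, ← mul_pow]
    norm_num
  have h9 : (0 : ℝ) < 9 ^ (n / 2) := by positivity
  rw [mul_pow, ← hs2] at h1 h2
  have hℓs : ℓ ≤ s := by
    rw [hℓ, Real.sqrt_le_iff]
    refine ⟨hs0.le, ?_⟩
    rw [div_le_iff₀ (by positivity)]
    refine le_of_mul_le_mul_right ?_ h9
    linarith
  have hsκ : s ≤ κ := by
    rw [hκ, Real.le_sqrt hs0.le (by positivity), le_div_iff₀ (by positivity)]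
    refine le_of_mul_le_mul_right ?_ h9
    linarith
  constructor
  · refine le_trans ?_ (le_norm_cantorOperator hj hR hsκ)
    rw [hm, hc₁, mul_assoc, mul_assoc, mul_assoc]
    gcongr
  · refine (norm_cantorOperator_le hC hK hj hR hℓ0 hℓs).trans ?_
    refine le_trans ?_ (mul_le_mul_of_nonneg_right (le_max_right c₁ c₂) hq0.le)
    rw [hm, hc₂, mul_assoc (40 * C), mul_assoc _ κ]
    gcongr
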